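/- An $f$-algebra is a real Riesz space (vector lattice) $A$ that is an associative algebra, not necessarily unital, such that $ab\ge 0$ whenever $a,b\ge 0$, and such that $a\wedge b=0$ and $c\ge 0$ imply $(ca)\wedge b=(ac)\wedge b=0$. It has the factorization property if it is Archimedean and for every $a\in A$ there exist $b,c\in A$ with $a=bc$. For a Riesz space $E$, let $E^{\sim}$ be its order dual, i.e. the Riesz space of all order bounded linear functionals on $E$, ordered by $f\le g$ iff $f(x)\le g(x)$ for all $x\ge 0$, and let $E^{\sim}_n\subseteq E^{\sim}$ be the set of order continuous functionals. Two elements $x,y$ of a Riesz space are disjoint, written $x\perp y$, if $|x|\wedge|y|=0$; two subsets $S,T$ are disjoint, written $S\perp T$, if $x\perp y$ for all $x\in S$, $y\in T$. For $f\in A^{\sim}$, $a\in A$ and $F\in (A^{\sim})^{\sim}$ define $f\cdot a\in A^{\sim}$ by $(f\cdot a)(b)=f(ab)$ for $b\in A$, and $F\cdot f\in A^{\sim}$ by $(F\cdot f)(a)=F(f\cdot a)$ for $a\in A$, and put $$R(f)=\{F\cdot f:\ F\in (A^{\sim})^{\sim}_n\}\subseteq A^{\sim}.$$ **Theorem.**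 Let $A$ be an $f$-algebra with the factorization property, and let $f,g\in A^{\sim}$. Then $f\perp g$ in $A^{\sim}$ if and only if $R(f)\perp R(g)$ in $A^{\sim}$. -/

import Mathlib

open Set Filter Topology

namespace RieszFAlg

universe u

/-! A Riesz space is a real vector space `E` with
`[AddCommGroup E] [Lattice E] [IsOrderedAddMonoid E] [Module ℝ E] [IsOrderedModule ℝ E]`. -/

section Riesz

variable {E : Type u} [AddCommGroup E] [Lattice E] [Module ℝ E]

/-- A linear functional is order bounded if it is bounded on every order interval. -/
def IsOrderBounded (f : E →ₗ[ℝ] ℝ) : Prop :=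
  ∀ a b : E, ∃ M : ℝ, ∀ x ∈ Icc a b, |f x| ≤ M

variable (E) in
/-- The vector space of all order bounded linear functionals on `E`. -/
def orderBoundedFunctionals : Submodule ℝ (E →ₗ[ℝ] ℝ) where
  carrier := {f | IsOrderBounded f}
  add_mem' := by
    intro f g hf hg a b
    obtain ⟨M, hM⟩ := hf a b
    obtain ⟨N, hN⟩ := hg a b
    refine ⟨M + N, fun x hx => ?_⟩
    exact (abs_add_le (f x) (g x)).trans (add_le_add (hM x hx) (hN x hx))
  zero_mem' := fun a b => ⟨0, fun x _ => by simp⟩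
  smul_mem' := by
    intro c f hf a b
    obtain ⟨M, hM⟩ := hf a b
    refine ⟨|c| * M, fun x hx => ?_⟩
    simp only [LinearMap.smul_apply, smul_eq_mul, abs_mul]
    exact mul_le_mul_of_nonneg_left (hM x hx) (abs_nonneg c)

variable (E) in
/-- The order dual `E~` of `E`: the order bounded linear functionals on `E`, which below is
ordered by `f ≤ g` iff `f x ≤ g x` for all `x ≥ 0`. -/
def RieszDual : Type u := ↥(orderBoundedFunctionals E)

noncomputable instance : AddCommGroup (RieszDual E) :=
  inferInstanceAs (AddCommGroup ↥(orderBoundedFunctionals E))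

noncomputable instance : Module ℝ (RieszDual E) :=
  inferInstanceAs (Module ℝ ↥(orderBoundedFunctionals E))

/-- The functional underlying an element of the order dual. -/
def RieszDual.toLin (f : RieszDual E) : E →ₗ[ℝ] ℝ := Subtype.val f

instance : CoeFun (RieszDual E) (fun _ => E → ℝ) := ⟨fun f => f.toLin⟩

theorem RieszDual.bdd (f : RieszDual E) : IsOrderBounded f.toLin := Subtype.property f

theorem RieszDual.add_apply (f g : RieszDual E) (x : E) : (f + g) x = f x + g x := rfl
theorem RieszDual.neg_apply (f : RieszDual E) (x : E) : (-f) x = -f x := rfl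
theorem RieszDual.sub_apply (f g : RieszDual E) (x : E) : (f - g) x = f x - g x := rfl
theorem RieszDual.zero_apply (x : E) : (0 : RieszDual E) x = 0 := rfl
theorem RieszDual.smul_apply (c : ℝ) (f : RieszDual E) (x : E) : (c • f) x = c * f x := rfl

theorem RieszDual.map_add (f : RieszDual E) (x y : E) : f (x + y) = f x + f y :=
  LinearMap.map_add f.toLin x y
theorem RieszDual.map_sub (f : RieszDual E) (x y : E) : f (x - y) = f x - f y :=
  LinearMap.map_sub f.toLin x y
theorem RieszDual.map_smul (f : RieszDual E) (c : ℝ) (x : E) : f (c • x) = c * f x :=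
  LinearMap.map_smul f.toLin c x
theorem RieszDual.map_zero (f : RieszDual E) : f (0 : E) = 0 :=
  LinearMap.map_zero f.toLin

theorem RieszDual.ext {f g : RieszDual E} (h : ∀ x, f x = g x) : f = g :=
  Subtype.ext (LinearMap.ext h)

variable [IsOrderedAddMonoid E]

instance : PartialOrder (RieszDual E) where
  le f g := ∀ x : E, 0 ≤ x → f x ≤ g x
  le_refl f x _ := le_rfl
  le_trans f g h h₁ h₂ x hx := (h₁ x hx).trans (h₂ x hx)
  le_antisymm f g h₁ h₂ := by
    apply RieszDual.ext
    intro x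
    have key : ∀ y : E, 0 ≤ y → f y = g y := fun y hy => le_antisymm (h₁ y hy) (h₂ y hy)
    have hx : x = x⁺ - x⁻ := (posPart_sub_negPart x).symm
    rw [hx, RieszDual.map_sub, RieszDual.map_sub, key _ (posPart_nonneg x),
      key _ (negPart_nonneg x)]

theorem RieszDual.le_iff {f g : RieszDual E} : f ≤ g ↔ ∀ x : E, 0 ≤ x → f x ≤ g x := Iff.rfl

/-- The value `f⁺(x) = sup {f y : 0 ≤ y ≤ x}` of the positive part of `f` at `x ≥ 0`. -/
noncomputable def conePos (f : RieszDual E) (x : E) : ℝ :=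
  sSup ((fun y => f y) '' Icc 0 x)

theorem bddAbove_cone (f : RieszDual E) (x : E) : BddAbove ((fun y => f y) '' Icc 0 x) := by
  obtain ⟨M, hM⟩ := f.bdd 0 x
  refine ⟨M, ?_⟩
  rintro _ ⟨y, hy, rfl⟩
  exact (le_abs_self _).trans (hM y hy)

theorem le_conePos (f : RieszDual E) {x y : E} (hy : 0 ≤ y) (hyx : y ≤ x) :
    f y ≤ conePos f x :=
  le_csSup (bddAbove_cone f x) ⟨y, ⟨hy, hyx⟩, rfl⟩

theorem conePos_le (f : RieszDual E) {x : E} (hx : 0 ≤ x) {M : ℝ}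
    (h : ∀ y, 0 ≤ y → y ≤ x → f y ≤ M) : conePos f x ≤ M := by
  refine csSup_le ⟨_, 0, ⟨le_rfl, hx⟩, rfl⟩ ?_
  rintro _ ⟨y, hy, rfl⟩
  exact h y hy.1 hy.2

theorem conePos_nonneg (f : RieszDual E) {x : E} (hx : 0 ≤ x) : 0 ≤ conePos f x := by
  have := le_conePos f (le_refl (0 : E)) hx
  rwa [RieszDual.map_zero] at this

theorem conePos_add (f : RieszDual E) {x y : E} (hx : 0 ≤ x) (hy : 0 ≤ y) :
    conePos f (x + y) = conePos f x + conePos f y := by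
  apply le_antisymm
  · refine conePos_le f (add_nonneg hx hy) fun z hz hzxy => ?_
    have h₁ : z - z ⊓ x ≤ y := by
      rw [sub_le_iff_le_add, add_comm, ← sub_le_iff_le_add]
      refine le_inf (sub_le_self z hy) ?_
      rwa [sub_le_iff_le_add]
    have h₂ : f z = f (z ⊓ x) + f (z - z ⊓ x) := by
      rw [← RieszDual.map_add]; congr 1; abel
    rw [h₂]
    exact add_le_add (le_conePos f (le_inf hz hx) inf_le_right)
      (le_conePos f (sub_nonneg.2 inf_le_left) h₁)
  · rw [← le_sub_iff_add_le]
    refine conePos_le f hx fun a ha hax => ?_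
    rw [le_sub_comm]
    refine conePos_le f hy fun b hb hby => ?_
    rw [le_sub_iff_add_le, add_comm, ← RieszDual.map_add]
    exact le_conePos f (add_nonneg ha hb) (add_le_add hax hby)

theorem conePos_zero (f : RieszDual E) : conePos f 0 = 0 := by
  have := conePos_add f (le_refl (0 : E)) le_rfl
  simp only [add_zero] at this
  linarith

theorem conePos_sub_eq (f : RieszDual E) {u v u' v' : E} (hu : 0 ≤ u) (hv : 0 ≤ v)
    (hu' : 0 ≤ u') (hv' : 0 ≤ v') (h : u - v = u' - v') :
    conePos f u - conePos f v = conePos f u' - conePos f v' := by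
  have h' : u + v' = u' + v := by
    rw [sub_eq_sub_iff_add_eq_add] at h; exact h
  have h₁ := conePos_add f hu hv'
  have h₂ := conePos_add f hu' hv
  rw [h'] at h₁
  linarith

variable [IsOrderedModule ℝ E]

theorem conePos_smul_le (f : RieszDual E) {c : ℝ} (hc : 0 < c) {x : E} (hx : 0 ≤ x) :
    conePos f (c • x) ≤ c * conePos f x := by
  refine conePos_le f (smul_nonneg hc.le hx) fun y hy hyx => ?_
  have h₁ : c⁻¹ • y ≤ x := by
    have := smul_le_smul_of_nonneg_left hyx (inv_nonneg.2 hc.le)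
    rwa [smul_smul, inv_mul_cancel₀ hc.ne', one_smul] at this
  have h₂ := le_conePos f (smul_nonneg (inv_nonneg.2 hc.le) hy) h₁
  rw [RieszDual.map_smul] at h₂
  rwa [inv_mul_le_iff₀ hc] at h₂

theorem conePos_smul (f : RieszDual E) {c : ℝ} (hc : 0 ≤ c) {x : E} (hx : 0 ≤ x) :
    conePos f (c • x) = c * conePos f x := by
  rcases hc.eq_or_lt with rfl | hc
  · simp [conePos_zero]
  apply le_antisymm (conePos_smul_le f hc hx)
  have := conePos_smul_le f (inv_pos.2 hc) (smul_nonneg hc.le hx)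
  rw [smul_smul, inv_mul_cancel₀ hc.ne', one_smul] at this
  rwa [le_inv_mul_iff₀ hc] at this

/-- The positive part of `f` as a linear functional. -/
noncomputable def posLin (f : RieszDual E) : E →ₗ[ℝ] ℝ where
  toFun x := conePos f x⁺ - conePos f x⁻
  map_add' x y := by
    have h : (x + y)⁺ - (x + y)⁻ = (x⁺ + y⁺) - (x⁻ + y⁻) := by
      rw [posPart_sub_negPart, add_sub_add_comm, posPart_sub_negPart, posPart_sub_negPart]
    rw [conePos_sub_eq f (posPart_nonneg _) (negPart_nonneg _)
      (add_nonneg (posPart_nonneg _) (posPart_nonneg _))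
      (add_nonneg (negPart_nonneg _) (negPart_nonneg _)) h,
      conePos_add f (posPart_nonneg _) (posPart_nonneg _),
      conePos_add f (negPart_nonneg _) (negPart_nonneg _)]
    ring
  map_smul' c x := by
    simp only [RingHom.id_apply, smul_eq_mul]
    rcases le_total 0 c with hc | hc
    · have h : (c • x)⁺ - (c • x)⁻ = c • x⁺ - c • x⁻ := by
        rw [posPart_sub_negPart, ← smul_sub, posPart_sub_negPart]
      rw [conePos_sub_eq f (posPart_nonneg _) (negPart_nonneg _)
        (smul_nonneg hc (posPart_nonneg _)) (smul_nonneg hc (negPart_nonneg _)) h,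
        conePos_smul f hc (posPart_nonneg _), conePos_smul f hc (negPart_nonneg _)]
      ring
    · have hc' : 0 ≤ -c := neg_nonneg.2 hc
      have h : (c • x)⁺ - (c • x)⁻ = (-c) • x⁻ - (-c) • x⁺ := by
        rw [posPart_sub_negPart, ← smul_sub, ← neg_sub x⁺ x⁻, posPart_sub_negPart, smul_neg,
          neg_smul, neg_neg]
      rw [conePos_sub_eq f (posPart_nonneg _) (negPart_nonneg _)
        (smul_nonneg hc' (negPart_nonneg _)) (smul_nonneg hc' (posPart_nonneg _)) h,
        conePos_smul f hc' (posPart_nonneg _), conePos_smul f hc' (negPart_nonneg _)]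
      ring

theorem posLin_of_nonneg (f : RieszDual E) {x : E} (hx : 0 ≤ x) : posLin f x = conePos f x := by
  change conePos f x⁺ - conePos f x⁻ = conePos f x
  rw [posPart_of_nonneg hx, negPart_of_nonneg hx, conePos_zero, sub_zero]

theorem posLin_mono (f : RieszDual E) {x y : E} (hxy : x ≤ y) : posLin f x ≤ posLin f y := by
  have h := conePos_nonneg f (sub_nonneg.2 hxy)
  rw [← posLin_of_nonneg f (sub_nonneg.2 hxy), LinearMap.map_sub] at h
  linarith

/-- The positive part `f⁺ = f ∨ 0` in the order dual. -/
noncomputable def dualPos (f : RieszDual E) : RieszDual E :=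
  ⟨posLin f, fun a b => ⟨max |posLin f a| |posLin f b|, fun _ hx =>
    abs_le_max_abs_abs (posLin_mono f hx.1) (posLin_mono f hx.2)⟩⟩

theorem dualPos_apply (f : RieszDual E) {x : E} (hx : 0 ≤ x) : dualPos f x = conePos f x :=
  posLin_of_nonneg f hx

theorem dualPos_nonneg (f : RieszDual E) : 0 ≤ dualPos f := fun x hx => by
  rw [dualPos_apply f hx]; exact conePos_nonneg f hx

theorem le_dualPos (f : RieszDual E) : f ≤ dualPos f := fun x hx => by
  rw [dualPos_apply f hx]; exact le_conePos f hx le_rfl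

theorem dualPos_le {f h : RieszDual E} (hf : f ≤ h) (h0 : 0 ≤ h) : dualPos f ≤ h := fun x hx => by
  rw [dualPos_apply f hx]
  refine conePos_le f hx fun y hy hyx => (hf y hy).trans ?_
  have h₁ := h0 (x - y) (sub_nonneg.2 hyx)
  rw [RieszDual.zero_apply, RieszDual.map_sub] at h₁
  linarith

instance : IsOrderedAddMonoid (RieszDual E) where
  add_le_add_left f g h k x hx := by
    have := h x hx
    rw [RieszDual.add_apply, RieszDual.add_apply]
    linarith

instance : IsOrderedModule ℝ (RieszDual E) where
  smul_le_smul_of_nonneg_left _ hc _ _ h x hx := mul_le_mul_of_nonneg_left (h x hx) hc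
  smul_le_smul_of_nonneg_right _ hf _ _ h x hx := mul_le_mul_of_nonneg_right h (hf x hx)

/-- The order dual is a Riesz space; `f ∨ g = g + (f - g)⁺` and `f ∧ g = f - (f - g)⁺`. -/
noncomputable instance : Lattice (RieszDual E) where
  sup f g := g + dualPos (f - g)
  inf f g := f - dualPos (f - g)
  le_sup_left f g := sub_le_iff_le_add'.1 (le_dualPos (f - g))
  le_sup_right f g := le_add_of_nonneg_right (dualPos_nonneg (f - g))
  sup_le f g h hf hg := by
    rw [add_comm, ← le_sub_iff_add_le]
    exact dualPos_le (sub_le_sub_right hf g) (sub_nonneg.2 hg)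
  inf_le_left f g := sub_le_self f (dualPos_nonneg (f - g))
  inf_le_right f g := sub_le_comm.1 (le_dualPos (f - g))
  le_inf h f g hf hg := by
    rw [le_sub_comm]
    exact dualPos_le (sub_le_sub_left hg f) (sub_nonneg.2 hf)

end Riesz

section Order

variable {E : Type u} [AddCommGroup E] [Lattice E]

/-- Disjointness `x ⊥ y` in a Riesz space. -/
def RieszDisjoint (x y : E) : Prop := |x| ⊓ |y| = 0

/-- Two sets are disjoint in the Riesz space sense if each element of one is disjoint from
each element of the other. -/
def SetsRieszDisjoint (S T : Set E) : Prop := ∀ x ∈ S, ∀ y ∈ T, RieszDisjoint x y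

variable (E) in
/-- Archimedean Riesz spaces. (The class `Archimedean` in the library is a different
condition, suited to linear orders.) -/
def IsArchimedeanRiesz : Prop := ∀ x y : E, 0 ≤ x → (∀ n : ℕ, n • x ≤ y) → x = 0

/-- Order convergence of a net `x` to `0`: it is dominated by a net decreasing to `0`. -/
def OrderTendstoZero {ι : Type*} [Preorder ι] (x : ι → E) : Prop :=
  ∃ y : ι → E, Antitone y ∧ IsGLB (range y) 0 ∧ ∀ i, |x i| ≤ y i

/-- A linear functional is order continuous if it maps nets that are order convergent to `0`
to nets converging to `0`. Index sets in the universe of `E` suffice: a violation by an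
arbitrary net yields one by a net indexed by a downward directed subset of `E`. -/
def IsOrderContinuous [Module ℝ E] (F : E →ₗ[ℝ] ℝ) : Prop :=
  ∀ (ι : Type u) [Preorder ι] [Nonempty ι] [IsDirectedOrder ι] (x : ι → E),
    OrderTendstoZero x → Tendsto (fun i => F (x i)) atTop (𝓝 0)

variable (E) in
/-- The order continuous part `E~ₙ` of the order dual `E~`. -/
def orderContinuousDual [Module ℝ E] : Submodule ℝ (RieszDual E) where
  carrier := {F | IsOrderContinuous F.toLin}
  add_mem' := by
    intro F G hF hG ι _ _ _ x hx
    have h := (hF ι x hx).add (hG ι x hx)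
    rw [add_zero] at h
    exact h
  zero_mem' := by
    intro ι _ _ _ x hx
    exact tendsto_const_nhds
  smul_mem' := by
    intro c F hF ι _ _ _ x hx
    have h := (hF ι x hx).const_mul c
    rw [mul_zero] at h
    exact h

end Order

section FAlgebra

/-- An `f`-algebra: a Riesz space which is an associative algebra (not necessarily unital) such
that products of positive elements are positive, and `a ∧ b = 0`, `c ≥ 0` imply
`(c a) ∧ b = (a c) ∧ b = 0`. -/
class IsFAlgebra (A : Type u) [NonUnitalRing A] [Lattice A] [Module ℝ A] : Prop
    extends IsOrderedAddMonoid A, IsOrderedModule ℝ A, IsScalarTower ℝ A A,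
      SMulCommClass ℝ A A where
  mul_nonneg' : ∀ a b : A, 0 ≤ a → 0 ≤ b → 0 ≤ a * b
  mul_left_inf : ∀ a b c : A, a ⊓ b = 0 → 0 ≤ c → (c * a) ⊓ b = 0
  mul_right_inf : ∀ a b c : A, a ⊓ b = 0 → 0 ≤ c → (a * c) ⊓ b = 0

/-- The factorization property: `A` is Archimedean and each element is a product of two. -/
def HasFactorizationProperty (A : Type u) [NonUnitalRing A] [Lattice A] : Prop :=
  IsArchimedeanRiesz A ∧ ∀ a : A, ∃ b c : A, a = b * c

variable {A : Type u} [NonUnitalRing A] [Lattice A] [Module ℝ A] [IsFAlgebra A]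

theorem mul_mono_left {a b c : A} (ha : 0 ≤ a) (h : b ≤ c) : a * b ≤ a * c := by
  have := IsFAlgebra.mul_nonneg' a (c - b) ha (sub_nonneg.2 h)
  rwa [mul_sub, sub_nonneg] at this

theorem mul_mono_right {a b c : A} (ha : 0 ≤ a) (h : b ≤ c) : b * a ≤ c * a := by
  have := IsFAlgebra.mul_nonneg' (c - b) a (sub_nonneg.2 h) ha
  rwa [sub_mul, sub_nonneg] at this

/-- The map `A × A~ → A~`, `(f · a)(b) = f (a b)`. -/
noncomputable def dualAct (f : RieszDual A) (a : A) : RieszDual A :=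
  ⟨f.toLin ∘ₗ LinearMap.mulLeft ℝ a, by
    intro b c
    obtain ⟨M, hM⟩ := f.bdd (a⁺ * b) (a⁺ * c)
    obtain ⟨N, hN⟩ := f.bdd (a⁻ * b) (a⁻ * c)
    refine ⟨M + N, fun x hx => ?_⟩
    have h₁ := hM (a⁺ * x) ⟨mul_mono_left (posPart_nonneg a) hx.1,
      mul_mono_left (posPart_nonneg a) hx.2⟩
    have h₂ := hN (a⁻ * x) ⟨mul_mono_left (negPart_nonneg a) hx.1,
      mul_mono_left (negPart_nonneg a) hx.2⟩
    have h₃ : a * x = a⁺ * x - a⁻ * x := by rw [← sub_mul, posPart_sub_negPart]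
    change |f (a * x)| ≤ M + N
    rw [h₃, RieszDual.map_sub]
    exact (abs_sub (f (a⁺ * x)) (f (a⁻ * x))).trans (add_le_add h₁ h₂)⟩

theorem dualAct_apply (f : RieszDual A) (a b : A) : dualAct f a b = f (a * b) := rfl

/-- The map `a ↦ f · a` is linear. -/
noncomputable def dualActLin (f : RieszDual A) : A →ₗ[ℝ] RieszDual A where
  toFun a := dualAct f a
  map_add' a b := RieszDual.ext fun x => by
    rw [RieszDual.add_apply, dualAct_apply, dualAct_apply, dualAct_apply, add_mul,
      RieszDual.map_add]
  map_smul' c a := RieszDual.ext fun x => by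
    rw [RingHom.id_apply, RieszDual.smul_apply, dualAct_apply, dualAct_apply, smul_mul_assoc,
      RieszDual.map_smul]

theorem dualAct_mono {f : RieszDual A} (hf : 0 ≤ f) {a b : A} (h : a ≤ b) :
    dualAct f a ≤ dualAct f b := fun x hx => by
  have := hf (b * x - a * x) (sub_nonneg.2 (mul_mono_right hx h))
  rw [RieszDual.zero_apply, RieszDual.map_sub] at this
  rw [dualAct_apply, dualAct_apply]
  linarith

/-- The map `(A~)~ × A~ → A~`, `(F · f)(a) = F (f · a)`. -/
noncomputable def bidualAct (F : RieszDual (RieszDual A)) (f : RieszDual A) : RieszDual A :=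
  ⟨F.toLin ∘ₗ dualActLin f, by
    intro b c
    obtain ⟨M, hM⟩ := F.bdd (dualAct f⁺ b) (dualAct f⁺ c)
    obtain ⟨N, hN⟩ := F.bdd (dualAct f⁻ b) (dualAct f⁻ c)
    refine ⟨M + N, fun x hx => ?_⟩
    have h₁ := hM (dualAct f⁺ x) ⟨dualAct_mono (posPart_nonneg f) hx.1,
      dualAct_mono (posPart_nonneg f) hx.2⟩
    have h₂ := hN (dualAct f⁻ x) ⟨dualAct_mono (negPart_nonneg f) hx.1,
      dualAct_mono (negPart_nonneg f) hx.2⟩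
    have h₃ : dualAct f x = dualAct f⁺ x - dualAct f⁻ x := RieszDual.ext fun y => by
      rw [RieszDual.sub_apply, dualAct_apply, dualAct_apply, dualAct_apply,
        ← RieszDual.sub_apply, posPart_sub_negPart]
    change |F (dualAct f x)| ≤ M + N
    rw [h₃, RieszDual.map_sub]
    exact (abs_sub (F (dualAct f⁺ x)) (F (dualAct f⁻ x))).trans (add_le_add h₁ h₂)⟩

theorem bidualAct_apply (F : RieszDual (RieszDual A)) (f : RieszDual A) (a : A) :
    bidualAct F f a = F (dualAct f a) := rfl

/-- `R(f) = {F · f : F ∈ (A~)~ₙ}`. -/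
def imageSet (f : RieszDual A) : Set (RieszDual A) :=
  {h | ∃ F ∈ orderContinuousDual (RieszDual A), h = bidualAct F f}

end FAlgebra

end RieszFAlg

namespace RieszFAlg

universe u

/-! ### Order duals: formulas for infimum and modulus, order null nets, evaluations -/

section Riesz

variable {E : Type u} [AddCommGroup E] [Lattice E] [Module ℝ E] [IsOrderedAddMonoid E]

/-! The core is that `f ⊥ g` implies `F · f ⊥ g` for order continuous `F`
(`RieszDisjoint.bidualAct_left`); using it on each side gives the forward direction. For `a ≥ 0`,
disjointness supplies `bₙ ∈ [0, a]` with `|f| bₙ + |g| (a - bₙ) < 4⁻ⁿ`. The inequality `k b x ≤ b x²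
+ k² b` with `k = 2ⁿ` (`smul_mul_le`) turns smallness of `|f| bₙ` into `|f| (bₙ x) ≤ 2⁻ⁿ (|f| (a x²)
+ 1)`. Hence `∑ |f| · bₙ` converges pointwise, and its tails decrease to `0` in the order dual. They
dominate `f · zₙ` whenever `|zₙ| ≤ bₙ`, so `F (f · zₙ) → 0`. Choosing `zₙ` nearly attaining `|F · f|
bₙ` makes `|F · f| bₙ + |g| (a - bₙ)` arbitrarily small.

For the converse, take `F` to be evaluation at `a ≥ 0`, so that `(F · f)(x) = f (x a)`. This action
commutes with the modulus, by the core applied to `f⁺ ⊥ f⁻`. Therefore `|f| ⊓ |g|` vanishes on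
products of positive elements, and factorization makes it zero. -/

theorem RieszDual.apply_nonneg {f : RieszDual E} (hf : 0 ≤ f) {x : E} (hx : 0 ≤ x) : 0 ≤ f x :=
  hf x hx

theorem RieszDual.apply_mono {f : RieszDual E} (hf : 0 ≤ f) {x y : E} (h : x ≤ y) : f x ≤ f y := by
  have := RieszDual.apply_nonneg hf (sub_nonneg.2 h)
  rw [RieszDual.map_sub] at this
  linarith

/-- A positive linear functional is order bounded. -/
noncomputable def RieszDual.ofNonneg (L : E →ₗ[ℝ] ℝ) (hL : ∀ x, 0 ≤ x → 0 ≤ L x) :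
    RieszDual E :=
  ⟨L, fun a b => ⟨max |L a| |L b|, fun x hx => by
    have h₁ := hL _ (sub_nonneg.2 hx.1)
    have h₂ := hL _ (sub_nonneg.2 hx.2)
    rw [LinearMap.map_sub] at h₁ h₂
    exact abs_le_max_abs_abs (by linarith) (by linarith)⟩⟩

theorem RieszDual.ofNonneg_apply (L : E →ₗ[ℝ] ℝ) (hL : ∀ x, 0 ≤ x → 0 ≤ L x) (x : E) :
    RieszDual.ofNonneg L hL x = L x := rfl

/-- A decreasing net of positive functionals with infimum `0` tends to `0` pointwise. -/
theorem RieszDual.tendsto_apply_of_antitone {ι : Type*} [Preorder ι] [Nonempty ι]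
    [IsDirectedOrder ι] {y : ι → RieszDual E} (hy : Antitone y) (h0 : IsGLB (range y) 0) (x : E) :
    Tendsto (fun i => y i x) atTop (𝓝 0) := by
  have hpos : ∀ i, 0 ≤ y i := fun i => h0.1 ⟨i, rfl⟩
  have hanti : ∀ x : E, 0 ≤ x → Antitone (fun i => y i x) := fun x hx i j hij => hy hij x hx
  have hbdd : ∀ x : E, 0 ≤ x → BddBelow (range fun i => y i x) := fun x hx =>
    ⟨0, by rintro _ ⟨i, rfl⟩; exact RieszDual.apply_nonneg (hpos i) hx⟩
  have hconv : ∀ x : E, ∃ l : ℝ, Tendsto (fun i => y i x) atTop (𝓝 l) := fun x => by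
    have h := (tendsto_atTop_ciInf (hanti _ (posPart_nonneg x)) (hbdd _ (posPart_nonneg x))).sub
      (tendsto_atTop_ciInf (hanti _ (negPart_nonneg x)) (hbdd _ (negPart_nonneg x)))
    refine ⟨_, h.congr fun i => ?_⟩
    rw [← RieszDual.map_sub, posPart_sub_negPart]
  choose l hl using hconv
  -- The pointwise limit is itself a positive functional and a lower bound of the net, so the
  -- infimum hypothesis forces it to be `0`.
  let L : E →ₗ[ℝ] ℝ := linearMapOfTendsto l (fun i => (y i).toLin) (tendsto_pi_nhds.2 hl)
  have hL : ∀ x, 0 ≤ x → 0 ≤ L x := fun x hx =>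
    ge_of_tendsto' (hl x) fun i => RieszDual.apply_nonneg (hpos i) hx
  have hle : RieszDual.ofNonneg L hL ≤ 0 := h0.2 <| by
    rintro _ ⟨i, rfl⟩ x hx
    exact (hanti x hx).le_of_tendsto (hl x) i
  have hL0 : RieszDual.ofNonneg L hL = 0 := le_antisymm hle hL
  have hx0 : l x = 0 := congrArg (fun f : RieszDual E => f x) hL0
  rw [← hx0]
  exact hl x

variable [IsOrderedModule ℝ E]

theorem RieszDual.abs_apply_le (f : RieszDual E) (x : E) : |f x| ≤ |f| |x| := by
  have key : ∀ y : E, 0 ≤ y → |f y| ≤ |f| y := fun y hy =>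
    abs_le'.2 ⟨le_abs_self f y hy, by
      rw [← RieszDual.neg_apply]; exact neg_le_abs f y hy⟩
  have hx : f x = f x⁺ - f x⁻ := by rw [← RieszDual.map_sub, posPart_sub_negPart]
  rw [hx, ← posPart_add_negPart x, RieszDual.map_add]
  exact (abs_sub _ _).trans
    (add_le_add (key _ (posPart_nonneg x)) (key _ (negPart_nonneg x)))

/-- Since `|f| = f ⊔ -f = -f + (2f)⁺`, a near-maximizer `y ∈ [0, b]` of `2f` yields the
near-maximizer `z = 2y - b ∈ [-b, b]` of `f`. -/
theorem RieszDual.exists_lt_abs_apply (f : RieszDual E) {b : E} (hb : 0 ≤ b) {ε : ℝ}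
    (hε : 0 < ε) : ∃ z : E, |z| ≤ b ∧ |f| b < f z + ε := by
  by_contra! H
  have h₁ : |f| b = -f b + conePos (f - -f) b := by
    rw [← dualPos_apply _ hb]; rfl
  have h₂ : conePos (f - -f) b ≤ |f| b + f b - ε := by
    refine conePos_le _ hb fun y hy hyb => ?_
    have h₃ : |y + y - b| ≤ b := by
      rw [abs_le']
      constructor
      · rw [sub_le_iff_le_add]; exact add_le_add hyb hyb
      · rw [neg_sub]; exact sub_le_self _ (add_nonneg hy hy)
    have h₄ := H _ h₃
    rw [RieszDual.map_sub, RieszDual.map_add] at h₄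
    rw [RieszDual.sub_apply, RieszDual.neg_apply]
    linarith
  linarith

theorem RieszDual.inf_apply (f g : RieszDual E) {a : E} (ha : 0 ≤ a) :
    (f ⊓ g) a = f a - conePos (f - g) a := by
  rw [← dualPos_apply _ ha]; rfl

/-- From `f ⊓ g = f - (f - g)⁺`, the value of `f ⊓ g` at `a` is the infimum of `f (a - y) + g y`
over `y ∈ [0, a]`; the witness is `b = a - y`. -/
theorem RieszDual.exists_lt_of_inf_eq_zero {f g : RieszDual E} (h : f ⊓ g = 0) {a : E}
    (ha : 0 ≤ a) {ε : ℝ} (hε : 0 < ε) : ∃ b ∈ Icc 0 a, f b + g (a - b) < ε := by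
  by_contra! H
  have h₁ := RieszDual.inf_apply f g ha
  rw [h, RieszDual.zero_apply] at h₁
  have h₂ : conePos (f - g) a ≤ f a - ε := by
    refine conePos_le _ ha fun y hy hya => ?_
    have h₃ := H (a - y) ⟨sub_nonneg.2 hya, sub_le_self _ hy⟩
    rw [sub_sub_cancel, RieszDual.map_sub] at h₃
    rw [RieszDual.sub_apply]
    linarith
  linarith

theorem RieszDual.inf_eq_zero {f g : RieszDual E} (hf : 0 ≤ f) (hg : 0 ≤ g)
    (H : ∀ a : E, 0 ≤ a → ∀ ε : ℝ, 0 < ε → ∃ b ∈ Icc 0 a, f b + g (a - b) < ε) :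
    f ⊓ g = 0 := by
  refine le_antisymm (fun a ha => ?_) (le_inf hf hg)
  rw [RieszDual.zero_apply]
  refine le_of_forall_pos_le_add fun ε hε => ?_
  obtain ⟨b, hb, hlt⟩ := H a ha ε hε
  have h₁ := le_conePos (f - g) (sub_nonneg.2 hb.2) (sub_le_self a hb.1)
  rw [RieszDual.inf_apply f g ha]
  rw [RieszDual.sub_apply, RieszDual.map_sub] at h₁
  linarith

/-- Evaluation at a positive element, as an element of the order bidual. -/
noncomputable def evalDual (a : E) (ha : 0 ≤ a) : RieszDual (RieszDual E) :=
  RieszDual.ofNonneg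
    { toFun := fun f => f a
      map_add' := fun _ _ => rfl
      map_smul' := fun _ _ => rfl }
    fun _ hf => hf a ha

theorem evalDual_mem (a : E) (ha : 0 ≤ a) :
    evalDual a ha ∈ orderContinuousDual (RieszDual E) := by
  rintro ι _ _ _ x ⟨y, hy, h0, hxy⟩
  refine squeeze_zero_norm (fun i => ?_) (RieszDual.tendsto_apply_of_antitone hy h0 a)
  have h := RieszDual.abs_apply_le (x i) a
  rw [abs_of_nonneg ha] at h
  exact h.trans (hxy i a ha)

/-- A pointwise summable series of positive functionals has an order null sequence of tails. -/
theorem orderTendstoZero_of_summable {u' : ℕ → RieszDual E} (hpos : ∀ n, 0 ≤ u' n)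
    (hs : ∀ x : E, 0 ≤ x → Summable fun n => u' n x) {v : ℕ → RieszDual E}
    (hv : ∀ n, |v n| ≤ u' n) : OrderTendstoZero fun n : ULift.{u} ℕ => v n.down := by
  have hs' : ∀ x : E, Summable fun n => u' n x := fun x => by
    refine ((hs _ (posPart_nonneg x)).sub (hs _ (negPart_nonneg x))).congr fun n => ?_
    rw [← RieszDual.map_sub, posPart_sub_negPart]
  have ht : ∀ (N : ℕ) (x : E), Summable fun n => u' (n + N) x := fun N x =>
    (summable_nat_add_iff N).2 (hs' x)
  -- The tail starts at the term `N` itself, so it dominates `u' N`, hence `|v N|`.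
  let L : ℕ → E →ₗ[ℝ] ℝ := fun N =>
    { toFun := fun x => ∑' n, u' (n + N) x
      map_add' := fun x y => by
        rw [← (ht N x).tsum_add (ht N y)]
        exact tsum_congr fun n => RieszDual.map_add _ _ _
      map_smul' := fun c x => by
        rw [RingHom.id_apply, smul_eq_mul, ← tsum_mul_left]
        exact tsum_congr fun n => RieszDual.map_smul _ _ _ }
  have hL : ∀ N x, 0 ≤ x → 0 ≤ L N x := fun N x hx =>
    tsum_nonneg fun n => RieszDual.apply_nonneg (hpos _) hx
  have hsucc : ∀ N x, L N x = u' N x + L (N + 1) x := fun N x => by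
    change ∑' n, u' (n + N) x = u' N x + ∑' n, u' (n + (N + 1)) x
    rw [(ht N x).tsum_eq_zero_add, Nat.zero_add]
    congr 1
    exact tsum_congr fun n => by rw [Nat.add_assoc, Nat.add_comm 1 N]
  have hanti : Antitone fun N => RieszDual.ofNonneg (L N) (hL N) :=
    antitone_nat_of_succ_le fun N x hx => by
      rw [RieszDual.ofNonneg_apply, RieszDual.ofNonneg_apply, hsucc N]
      linarith [RieszDual.apply_nonneg (hpos N) hx]
  refine ⟨fun n => RieszDual.ofNonneg (L n.down) (hL n.down), fun i j hij => hanti hij,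
    ⟨?_, fun h hh x hx => ?_⟩, fun i => (hv i.down).trans fun x hx => ?_⟩
  · rintro _ ⟨i, rfl⟩
    exact hL i.down
  -- Tails of a convergent series tend to `0`, so a lower bound of all tails is nonpositive on the
  -- positive cone.
  · exact ge_of_tendsto' (tendsto_sum_nat_add fun n => u' n x) fun N => hh ⟨⟨N⟩, rfl⟩ x hx
  · rw [RieszDual.ofNonneg_apply, hsucc]
    linarith [hL (i.down + 1) x hx]

end Riesz

/-! ### Disjointness in Riesz spaces -/

section Disjoint

variable {E : Type u} [AddCommGroup E] [Lattice E]

theorem RieszDisjoint.symm {x y : E} (h : RieszDisjoint x y) : RieszDisjoint y x := by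
  rwa [RieszDisjoint, inf_comm]

variable [IsOrderedAddMonoid E]

theorem abs_sub_of_inf_eq_zero {x y : E} (h : x ⊓ y = 0) : |x - y| = x + y := by
  rw [← sup_sub_inf_eq_abs_sub, inf_comm y x, h, sub_zero, ← inf_add_sup x y, h, zero_add,
    sup_comm]

/-- If `w ⊓ p = 0` and `w ≤ p + q`, then `w ≤ q`. -/
theorem le_of_le_add_of_inf_eq_zero {w p q : E} (hq : 0 ≤ q)
    (h : w ⊓ p = 0) (hle : w ≤ p + q) : w ≤ q := by
  have h₁ : w - q ≤ w ⊓ p := le_inf (sub_le_self w hq) (sub_le_iff_le_add.2 hle)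
  rwa [h, sub_nonpos] at h₁

end Disjoint

/-! ### Disjointness under the module actions of an `f`-algebra -/

section FAlgebra

variable {A : Type u} [NonUnitalRing A] [Lattice A] [Module ℝ A] [IsFAlgebra A]

theorem smul_inf_eq_zero {a b : A} {k : ℝ} (hk : 0 < k) (h : a ⊓ b = 0) :
    a ⊓ k • b = 0 := by
  have ha : 0 ≤ a := h ▸ inf_le_left
  have hb : 0 ≤ b := h ▸ inf_le_right
  refine le_antisymm ?_ (le_inf ha (smul_nonneg hk.le hb))
  have hm : 0 < max 1 k := lt_max_of_lt_left one_pos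
  have hm' : 0 ≤ (max 1 k)⁻¹ := inv_nonneg.2 hm.le
  set w := a ⊓ k • b
  have hw : 0 ≤ w := le_inf ha (smul_nonneg hk.le hb)
  -- Dividing by `max 1 k` brings `w` below `a` because it is at least `1`, and below `b` because it
  -- is at least `k`.
  have key : (max 1 k)⁻¹ • w ≤ a ⊓ b := by
    refine le_inf ?_ ?_
    · calc (max 1 k)⁻¹ • w ≤ (1 : ℝ) • w :=
            smul_le_smul_of_nonneg_right (inv_le_one_of_one_le₀ (le_max_left _ _)) hw
        _ = w := one_smul _ _
        _ ≤ a := inf_le_left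
    · calc (max 1 k)⁻¹ • w ≤ (max 1 k)⁻¹ • (max 1 k) • b :=
            smul_le_smul_of_nonneg_left
              (inf_le_right.trans (smul_le_smul_of_nonneg_right (le_max_right _ _) hb)) hm'
        _ = b := by rw [smul_smul, inv_mul_cancel₀ hm.ne', one_smul]
  rw [h] at key
  have := smul_le_smul_of_nonneg_left key hm.le
  rwa [smul_smul, mul_inv_cancel₀ hm.ne', one_smul, smul_zero] at this

/-- In an `f`-algebra `k b x ≤ b x² + k² b` for positive `b`, `x`. -/
theorem smul_mul_le {b x : A} (hb : 0 ≤ b) (hx : 0 ≤ x) {k : ℝ} (hk : 0 < k) :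
    k • (b * x) ≤ b * x * x + (k * k) • b := by
  -- Heuristically, `p⁺` and `p⁻` live where `x ≥ k` and `x ≤ k`. As `b x² - k b x = p x`, only `p⁻
  -- x` has to be bounded.
  set p := b * x - k • b with hp
  have huv : p⁻ ⊓ p⁺ = 0 := by rw [inf_comm]; exact posPart_inf_negPart_eq_zero p
  -- Multiplication by `x` keeps `p⁻ x` disjoint from `k p⁺`, so that summand drops out of the bound
  -- `p⁻ x ≤ k p⁺ + k² b`.
  have hkey : p⁻ * x ≤ (k * k) • b := by
    refine le_of_le_add_of_inf_eq_zero (p := k • p⁺) (smul_nonneg (mul_self_nonneg k) hb)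
      (smul_inf_eq_zero hk (IsFAlgebra.mul_right_inf _ _ _ huv hx)) ?_
    have h₁ : p⁻ ≤ k • b := by
      rw [negPart_def, hp, neg_sub]
      exact sup_le (sub_le_self _ (IsFAlgebra.mul_nonneg' _ _ hb hx)) (smul_nonneg hk.le hb)
    calc p⁻ * x ≤ (k • b) * x := mul_mono_right hx h₁
      _ = k • (p + k • b) := by rw [hp, sub_add_cancel, smul_mul_assoc]
      _ = k • p + (k * k) • b := by rw [smul_add, smul_smul]
      _ ≤ k • p⁺ + (k * k) • b := by
        gcongr
        exact le_posPart p
  have h₂ : b * x * x - k • (b * x) = p⁺ * x - p⁻ * x := by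
    rw [← sub_mul, posPart_sub_negPart, hp, sub_mul, smul_mul_assoc]
  have h₃ : b * x * x + (k * k) • b - k • (b * x)
      = p⁺ * x + ((k * k) • b - p⁻ * x) := by
    rw [add_sub_right_comm, h₂]; abel
  rw [← sub_nonneg, h₃]
  exact add_nonneg (IsFAlgebra.mul_nonneg' _ _ (posPart_nonneg p) hx) (sub_nonneg.2 hkey)

theorem dualAct_nonneg {f : RieszDual A} (hf : 0 ≤ f) {a : A} (ha : 0 ≤ a) :
    0 ≤ dualAct f a :=
  fun _ hx => RieszDual.apply_nonneg hf (IsFAlgebra.mul_nonneg' _ _ ha hx)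

theorem abs_dualAct_le (f : RieszDual A) {z b : A} (h : |z| ≤ b) :
    |dualAct f z| ≤ dualAct |f| b := by
  have key : ∀ x : A, 0 ≤ x → |f (z * x)| ≤ |f| (b * x) := fun x hx => by
    refine (RieszDual.abs_apply_le f _).trans
      (RieszDual.apply_mono (abs_nonneg f) (le_trans ?_ (mul_mono_right hx h)))
    refine abs_le'.2 ⟨mul_mono_right hx (le_abs_self z), ?_⟩
    rw [← neg_mul]
    exact mul_mono_right hx (neg_le_abs z)
  exact abs_le'.2 ⟨fun x hx => (le_abs_self _).trans (key x hx),
    fun x hx => (neg_le_abs _).trans (key x hx)⟩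

/-- If `f (bₙ) ≤ 4⁻ⁿ` with `0 ≤ bₙ ≤ a`, the series `∑ f · bₙ` is pointwise summable. -/
theorem summable_dualAct {f : RieszDual A} (hf : 0 ≤ f) {a : A} {b : ℕ → A}
    (hb : ∀ n, b n ∈ Icc 0 a) (hfb : ∀ n, f (b n) ≤ (1 / 4) ^ n) {x : A} (hx : 0 ≤ x) :
    Summable fun n => dualAct f (b n) x := by
  refine Summable.of_nonneg_of_le
    (fun n => RieszDual.apply_nonneg (dualAct_nonneg hf (hb n).1) hx) (fun n => ?_)
    (summable_geometric_two.mul_left (f (a * x * x) + 1))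
  -- With `k = 2ⁿ`, the factor `k²` exactly cancels `4⁻ⁿ`, and dividing by `k` leaves a geometric
  -- bound.
  have hk : (0 : ℝ) < 2 ^ n := by positivity
  have h₁ := RieszDual.apply_mono hf (smul_mul_le (hb n).1 hx hk)
  have h₂ := RieszDual.apply_mono hf (mul_mono_right hx (mul_mono_right hx (hb n).2))
  rw [RieszDual.map_add, RieszDual.map_smul, RieszDual.map_smul] at h₁
  have h₃ : (2 : ℝ) ^ n * 2 ^ n * f (b n) ≤ 1 := by
    calc (2 : ℝ) ^ n * 2 ^ n * f (b n) ≤ 2 ^ n * 2 ^ n * (1 / 4) ^ n := by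
          gcongr
          exact hfb n
      _ = 1 := by rw [← mul_pow, ← mul_pow]; norm_num
  rw [dualAct_apply, one_div, inv_pow, ← div_eq_mul_inv, le_div_iff₀ hk]
  linarith

/-- Acting by an order continuous functional preserves disjointness. -/
theorem RieszDisjoint.bidualAct_left {f g : RieszDual A} (h : RieszDisjoint f g)
    {F : RieszDual (RieszDual A)} (hF : F ∈ orderContinuousDual (RieszDual A)) :
    RieszDisjoint (bidualAct F f) g := by
  refine RieszDual.inf_eq_zero (abs_nonneg _) (abs_nonneg _) fun a ha ε hε => ?_
  have h₁ : ∀ n : ℕ, ∃ b ∈ Icc 0 a, |f| b + |g| (a - b) < (1 / 4) ^ n := fun n =>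
    RieszDual.exists_lt_of_inf_eq_zero h ha (by positivity)
  choose b hb hlt using h₁
  have h₂ : ∀ n : ℕ, ∃ z : A, |z| ≤ b n ∧
      |bidualAct F f| (b n) < bidualAct F f z + (1 / 4) ^ n := fun n =>
    RieszDual.exists_lt_abs_apply _ (hb n).1 (by positivity)
  choose z hz hzlt using h₂
  have hf : ∀ n, |f| (b n) ≤ (1 / 4) ^ n := fun n => by
    linarith [hlt n, RieszDual.apply_nonneg (abs_nonneg g) (sub_nonneg.2 (hb n).2)]
  have hg : ∀ n, |g| (a - b n) ≤ (1 / 4) ^ n := fun n => by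
    linarith [hlt n, RieszDual.apply_nonneg (abs_nonneg f) (hb n).1]
  have hnull : OrderTendstoZero fun n : ULift.{u} ℕ => dualAct f (z n.down) :=
    orderTendstoZero_of_summable (fun n => dualAct_nonneg (abs_nonneg f) (hb n).1)
      (fun _ hx => summable_dualAct (abs_nonneg f) hb hf hx) (fun n => abs_dualAct_le f (hz n))
  have hlim := hF (ULift.{u} ℕ) _ hnull
  obtain ⟨N, hN⟩ := eventually_atTop.1 (hlim.eventually (gt_mem_nhds (half_pos hε)))
  have hpow : Tendsto (fun n : ℕ => (1 / 4 : ℝ) ^ n) atTop (𝓝 0) :=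
    tendsto_pow_atTop_nhds_zero_of_lt_one (by norm_num) (by norm_num)
  -- The budget is `ε/2` for `F (f · zₙ)`, `ε/4` for the error in choosing `zₙ`, and `ε/4` for `|g|
  -- (a - bₙ)`.
  obtain ⟨n, hn, hnN⟩ := ((hpow.eventually (gt_mem_nhds (show 0 < ε / 4 by linarith))).and
    (eventually_ge_atTop N.down)).exists
  refine ⟨b n, hb n, ?_⟩
  have h₃ : bidualAct F f (z n) < ε / 2 := hN ⟨n⟩ hnN
  linarith [hzlt n, hg n]

theorem bidualAct_sub (F : RieszDual (RieszDual A)) (f g : RieszDual A) :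
    bidualAct F (f - g) = bidualAct F f - bidualAct F g :=
  RieszDual.ext fun x => (RieszDual.map_sub F (dualAct f x) (dualAct g x) :)

/-- Evaluations are order continuous, so their action preserves `f⁺ ⊥ f⁻`, and the modulus of a
difference of disjoint positive elements is their sum. -/
theorem abs_bidualAct_evalDual (f : RieszDual A) {a : A} (ha : 0 ≤ a) :
    |bidualAct (evalDual a ha) f| = bidualAct (evalDual a ha) |f| := by
  have hnn : ∀ h : RieszDual A, 0 ≤ h → 0 ≤ bidualAct (evalDual a ha) h := fun h hh x hx =>
    RieszDual.apply_nonneg hh (IsFAlgebra.mul_nonneg' _ _ hx ha)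
  have h₀ : RieszDisjoint f⁺ f⁻ := by
    rw [RieszDisjoint, abs_of_nonneg (posPart_nonneg f), abs_of_nonneg (negPart_nonneg f)]
    exact posPart_inf_negPart_eq_zero f
  have h₁ := ((h₀.bidualAct_left (evalDual_mem a ha)).symm.bidualAct_left
    (evalDual_mem a ha)).symm
  rw [RieszDisjoint, abs_of_nonneg (hnn _ (posPart_nonneg f)),
    abs_of_nonneg (hnn _ (negPart_nonneg f))] at h₁
  conv_lhs => rw [← posPart_sub_negPart f, bidualAct_sub, abs_sub_of_inf_eq_zero h₁]
  rw [← posPart_add_negPart f]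
  rfl

/-- A functional vanishing on products of positive elements is zero if all elements factor. -/
theorem eq_zero_of_apply_mul_eq_zero (hA : ∀ a : A, ∃ b c : A, a = b * c) {h : RieszDual A}
    (hh : ∀ x a : A, 0 ≤ x → 0 ≤ a → h (x * a) = 0) : h = 0 := by
  refine RieszDual.ext fun y => ?_
  obtain ⟨b, c, rfl⟩ := hA y
  rw [← posPart_sub_negPart b, ← posPart_sub_negPart c, sub_mul, mul_sub, mul_sub,
    RieszDual.map_sub, RieszDual.map_sub, RieszDual.map_sub,
    hh _ _ (posPart_nonneg b) (posPart_nonneg c), hh _ _ (posPart_nonneg b) (negPart_nonneg c),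
    hh _ _ (negPart_nonneg b) (posPart_nonneg c), hh _ _ (negPart_nonneg b) (negPart_nonneg c),
    RieszDual.zero_apply]
  simp

end FAlgebra

end RieszFAlg

theorem theorem2p5 {A : Type*} [NonUnitalRing A] [Lattice A] [Module ℝ A]
    [RieszFAlg.IsFAlgebra A] (hA : RieszFAlg.HasFactorizationProperty A)
    (f g : RieszFAlg.RieszDual A) :
    RieszFAlg.RieszDisjoint f g ↔
      RieszFAlg.SetsRieszDisjoint (RieszFAlg.imageSet f) (RieszFAlg.imageSet g) := by
  open RieszFAlg in
  constructor
  · rintro h _ ⟨F, hF, rfl⟩ _ ⟨G, hG, rfl⟩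
    exact ((h.bidualAct_left hF).symm.bidualAct_left hG).symm
  · intro H
    refine eq_zero_of_apply_mul_eq_zero hA.2 fun x a hx ha => ?_
    have h₁ := H _ ⟨_, evalDual_mem a ha, rfl⟩ _ ⟨_, evalDual_mem a ha, rfl⟩
    rw [RieszDisjoint, abs_bidualAct_evalDual, abs_bidualAct_evalDual] at h₁
    have hpos : 0 ≤ |f| ⊓ |g| := le_inf (abs_nonneg f) (abs_nonneg g)
    -- Monotonicity of the action puts the image of the infimum below the infimum of the images,
    -- which is `0`.
    have h₂ : bidualAct (evalDual a ha) (|f| ⊓ |g|) ≤ 0 := by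
      rw [← h₁]
      refine le_inf (fun y hy => ?_) (fun y hy => ?_)
      · exact (inf_le_left : |f| ⊓ |g| ≤ |f|) _ (IsFAlgebra.mul_nonneg' _ _ hy ha)
      · exact (inf_le_right : |f| ⊓ |g| ≤ |g|) _ (IsFAlgebra.mul_nonneg' _ _ hy ha)
    exact le_antisymm (h₂ x hx)
      (RieszDual.apply_nonneg hpos (IsFAlgebra.mul_nonneg' _ _ hx ha))
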